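/- Let $b>0$ and $\sigma\in L_2(0,b)$, and let $\Delta(\lambda)=1-\lambda\int_0^b e^{i\lambda x}\,\overline{\sigma(x)}\,dx$, an entire function with $\Delta(0)=1$. (It is the characteristic function of the operator $Ly=-iy'$ in $L_2(0,b)$ with domain $\{y\in W_2^1[0,b]: U(y)=0\}$, where $U(y)=y(0)-\int_0^b(-iy'(x))\overline{\sigma(x)}\,dx$.) For smooth functions $g,f$ on $[0,b]$ and $x\in[0,b]$ define the convolution $$(g*f)(x)=i\int_0^x g(x-\xi)f(\xi)\,d\xi-\int_0^b\overline{\sigma(\mu)}\,\frac{\partial}{\partial\mu}\Big(\int_\mu^x g(x-\xi+\mu)f(\xi)\,d\xi\Big)d\mu .$$ Let $\lambda_n$ be a zero of $\Delta$, of multiplicity $m_n\ge 1$. Let $d_{j,n}$ be the value at $\lambda=\lambda_n$ of the $j$-th derivative of the function $(\lambda-\lambda_n)^{m_n}/\Delta(\lambda)$ (with its removable singularity at $\lambda_n$ filled in), and define the root functions of $L$ at $\lambda_n$ by $$u_{s,n}(x)=-\sum_{j=0}^{s}\frac{d_{j,n}}{j!}\,\frac{(ix)^{s-j}}{(s-j)!}\,e^{i\lambda_n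 x},\qquad 0\le s\le m_n-1 .$$ **Lemma 4.1.** For all integers $0\le p,q\le m_n-1$ and all $x\in[0,b]$, $$(u_{p,n}*u_{q,n})(x)=\begin{cases}0,& p+q<m_n-1,\\ u_{p+q-m_n+1,n}(x),& p+q\ge m_n-1.\end{cases}$$ In particular $u_{m_n-1,n}*u_{m_n-1,n}=u_{m_n-1,n}$. -/

import Mathlib

open MeasureTheory Filter Topology

noncomputable section

namespace SegmentConv

/-- The characteristic function
`Δ(z) = 1 - z ∫₀ᵇ exp(i z x) conj(σ(x)) dx`
of the operator `L y = -i y'` on `L₂(0,b)` with the boundary condition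
`y(0) - ∫₀ᵇ (-i y'(x)) conj(σ(x)) dx = 0`. -/
def Delta (b : ℝ) (σ : ℝ → ℂ) (z : ℂ) : ℂ :=
  1 - z * ∫ x in (0 : ℝ)..b, Complex.exp (Complex.I * z * x) * starRingEnd ℂ (σ x)

/-- The convolution generated by `L`:
`(g ∗ f)(x) = i ∫₀ˣ g(x-ξ) f(ξ) dξ - ∫₀ᵇ conj(σ(μ)) ∂/∂μ (∫_μˣ g(x-ξ+μ) f(ξ) dξ) dμ`.
For `x ∈ [0,b]` it only involves the values of `f` and `g` on `[0,b]`. -/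
def conv (b : ℝ) (σ g f : ℝ → ℂ) (x : ℝ) : ℂ :=
  Complex.I * (∫ ξ in (0 : ℝ)..x, g (x - ξ) * f ξ) -
    ∫ μ in (0 : ℝ)..b,
      starRingEnd ℂ (σ μ) * deriv (fun ν : ℝ => ∫ ξ in ν..x, g (x - ξ + ν) * f ξ) μ

/-- The multiplicity of `lam` as a zero of `Δ`. -/
def mult (b : ℝ) (σ : ℝ → ℂ) (lam : ℂ) : ℕ :=
  analyticOrderNatAt (Delta b σ) lam

/-- The function `(z - lam)^m / Δ(z)`, where `m` is the multiplicity of `lam`, with the removable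
singularity at `lam` filled in by the limit. -/
def regQuot (b : ℝ) (σ : ℝ → ℂ) (lam : ℂ) : ℂ → ℂ :=
  Function.update (fun z => (z - lam) ^ mult b σ lam / Delta b σ z) lam
    (limUnder (𝓝[≠] lam) fun z => (z - lam) ^ mult b σ lam / Delta b σ z)

/-- `dCoeff b σ lam j / j!` is the `j`-th Taylor coefficient of `(z - lam)^m / Δ(z)` at `lam`. -/
def dCoeff (b : ℝ) (σ : ℝ → ℂ) (lam : ℂ) (j : ℕ) : ℂ :=
  iteratedDeriv j (regQuot b σ lam) lam

/-- The root functions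
`u_s(x) = - ∑_{j=0}^{s} (d_j / j!) ((i x)^(s-j) / (s-j)!) exp(i lam x)`, `0 ≤ s ≤ m - 1`.
The function `u_{m-1}` is minus the residue at `z = lam` of `exp(i z x) / Δ(z)`, so that
`u_{m-1} ∗ f` is the Riesz projection `-(1/2πi) ∮ (L - z)⁻¹ f dz` of `f`. -/
def rootFun (b : ℝ) (σ : ℝ → ℂ) (lam : ℂ) (s : ℕ) (x : ℝ) : ℂ :=
  -∑ j ∈ Finset.range (s + 1),
    dCoeff b σ lam j / (j.factorial : ℂ) *
      ((Complex.I * x) ^ (s - j) / ((s - j).factorial : ℂ) * Complex.exp (Complex.I * lam * x))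

/-- The root functions form a chain: `u_s = L u_{s+1} - lam u_{s+1}` with `L y = -i y'`. -/
theorem rootFun_chain (b : ℝ) (σ : ℝ → ℂ) (lam : ℂ) (s : ℕ) (x : ℝ) :
    rootFun b σ lam s x =
      -Complex.I * deriv (rootFun b σ lam (s + 1)) x - lam * rootFun b σ lam (s + 1) x := by
  have hE : HasDerivAt (fun y : ℝ => Complex.exp (Complex.I * lam * y))
      (Complex.exp (Complex.I * lam * x) * (Complex.I * lam * 1)) x :=
    ((Complex.ofRealCLM.hasDerivAt (x := x)).const_mul (Complex.I * lam)).cexp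
  have hI : HasDerivAt (fun y : ℝ => Complex.I * (y : ℂ)) (Complex.I * 1) x :=
    (Complex.ofRealCLM.hasDerivAt (x := x)).const_mul Complex.I
  have hD : HasDerivAt (rootFun b σ lam (s + 1)) _ x :=
    (HasDerivAt.fun_sum (u := Finset.range (s + 1 + 1)) fun j _ =>
      (((hI.pow (s + 1 - j)).div_const ((s + 1 - j).factorial : ℂ)).mul hE).const_mul
        (dCoeff b σ lam j / (j.factorial : ℂ))).neg
  rw [hD.deriv]
  have hII := Complex.I_mul_I
  simp only [rootFun]
  rw [← sub_eq_zero, neg_mul, mul_neg, mul_neg, neg_neg, sub_neg_eq_add, Finset.mul_sum,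
    Finset.mul_sum, ← Finset.sum_add_distrib, Finset.sum_range_succ _ (s + 1), sub_eq_zero,
    ← Finset.sum_neg_distrib]
  have last : ∀ a e : ℂ, Complex.I * (a * (0 + 1 / 1 * (e * (Complex.I * lam * 1)))) +
      lam * (a * (1 / 1 * e)) = 0 := by
    intro a e
    linear_combination (a * e * lam) * hII
  have hz := last (dCoeff b σ lam (s + 1) / ((s + 1).factorial : ℂ))
    (Complex.exp (Complex.I * lam * x))
  simp only [Nat.sub_self, Pi.pow_apply, pow_zero, Nat.factorial_zero, Nat.cast_zero, Nat.cast_one,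
    zero_mul, zero_div] at hz ⊢
  rw [hz, add_zero]
  refine Finset.sum_congr rfl fun j hj => ?_
  have hj' : s + 1 - j = (s - j) + 1 := by
    have := Finset.mem_range.1 hj
    omega
  have h1 : ((s - j : ℕ) : ℂ) + 1 ≠ 0 := by exact_mod_cast Nat.succ_ne_zero (s - j)
  have h2 : ((s - j).factorial : ℂ) ≠ 0 := by exact_mod_cast Nat.factorial_ne_zero _
  have h3 : (j.factorial : ℂ) ≠ 0 := by exact_mod_cast Nat.factorial_ne_zero _
  rw [hj', Nat.factorial_succ, Nat.add_sub_cancel]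
  generalize (s - j).factorial = F at *
  generalize j.factorial = G at *
  generalize Complex.exp (Complex.I * lam * x) = e at *
  generalize s - j = k at *
  generalize dCoeff b σ lam j = d at *
  push_cast
  field_simp
  rw [pow_succ]
  linear_combination (-(d * e * (Complex.I * x) ^ k) * ((k : ℂ) + 1 + Complex.I * x * lam)) * hII

end SegmentConv

end

/-! Let `e_k` be the coefficient of `t^k` in `E(t) = exp(i(lam+t)x)` and `δ_k` that of `Δ(lam+t)`.
For two exponentials the convolution is `(Δ(z) exp(iwx) - Δ(w) exp(izx)) / (w - z)`, because the
boundary functional `U` sends `exp(izx)` to `Δ(z)`. Comparing coefficients gives `conv_expCoeff`. If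
`p, q < m`, the vanishing of `δ_k` for `k < m` reduces this to `e_p * e_q = -[t^(p+q+1)] Δ E`
(`conv_expCoeff_eq_coeff`).

With `A = t^m / Δ` one has `u_s = -[t^s] A E` (`rootFun_eq_coeff`). By bilinearity `u_p * u_q =
-[t^(p+q+1)] A² Δ E`, where `t^m ∣ Δ E` makes the truncated double sum the full coefficient
(`sum_coeff_mul_coeff_mul_coeff`). Since `A Δ = t^m`, this equals `-[t^(p+q+1)] t^m A E`, which is
`0` or `u_{p+q+1-m}`. -/

noncomputable section

namespace SegmentConv

/-! ### Divided Taylor coefficients of the exponential and their products -/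

/-- The divided Taylor coefficients `(i x)^k / k! * exp(i lam x)` of `z ↦ exp(i z x)` at `lam`. -/
def expCoeff (lam : ℂ) (k : ℕ) (x : ℝ) : ℂ :=
  (Complex.I * x) ^ k / (k.factorial : ℂ) * Complex.exp (Complex.I * lam * x)

theorem hasDerivAt_expCoeff_zero (lam : ℂ) (x : ℝ) :
    HasDerivAt (expCoeff lam 0) (Complex.I * lam * expCoeff lam 0 x) x := by
  have hE : HasDerivAt (fun y : ℝ => Complex.exp (Complex.I * lam * y))
      (Complex.exp (Complex.I * lam * x) * (Complex.I * lam * 1)) x :=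
    ((Complex.ofRealCLM.hasDerivAt (x := x)).const_mul (Complex.I * lam)).cexp
  have : expCoeff lam 0 = fun y : ℝ => Complex.exp (Complex.I * lam * y) := by
    ext y; simp [expCoeff]
  rw [this]
  convert hE using 1
  ring

theorem hasDerivAt_expCoeff_succ (lam : ℂ) (k : ℕ) (x : ℝ) :
    HasDerivAt (expCoeff lam (k + 1))
      (Complex.I * (lam * expCoeff lam (k + 1) x + expCoeff lam k x)) x := by
  have hE : HasDerivAt (fun y : ℝ => Complex.exp (Complex.I * lam * y))
      (Complex.exp (Complex.I * lam * x) * (Complex.I * lam * 1)) x :=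
    ((Complex.ofRealCLM.hasDerivAt (x := x)).const_mul (Complex.I * lam)).cexp
  have hI : HasDerivAt (fun y : ℝ => Complex.I * (y : ℂ)) (Complex.I * 1) x :=
    (Complex.ofRealCLM.hasDerivAt (x := x)).const_mul Complex.I
  refine (((hI.fun_pow (k + 1)).div_const ((k + 1).factorial : ℂ)).fun_mul hE).congr_deriv ?_
  have h1 : (k : ℂ) + 1 ≠ 0 := by exact_mod_cast Nat.succ_ne_zero k
  have h2 : (k.factorial : ℂ) ≠ 0 := by exact_mod_cast Nat.factorial_ne_zero _
  simp only [expCoeff, Nat.factorial_succ, Nat.add_sub_cancel]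
  push_cast
  field_simp
  ring

theorem differentiable_expCoeff (lam : ℂ) (k : ℕ) : Differentiable ℝ (expCoeff lam k) := by
  intro x
  cases k with
  | zero => exact (hasDerivAt_expCoeff_zero lam x).differentiableAt
  | succ k => exact (hasDerivAt_expCoeff_succ lam k x).differentiableAt

@[fun_prop]
theorem continuous_expCoeff (lam : ℂ) (k : ℕ) : Continuous (expCoeff lam k) :=
  (differentiable_expCoeff lam k).continuous

theorem expCoeff_zero_right (lam : ℂ) (k : ℕ) :
    expCoeff lam k 0 = if k = 0 then 1 else 0 := by
  rcases k with _ | k <;> simp [expCoeff]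

/-- The integral over `[ν, x]` of the product of `expCoeff lam p (x - ξ + ν)` and
`expCoeff lam q ξ`. -/
theorem integral_expCoeff_mul (lam : ℂ) (p q : ℕ) (ν x : ℝ) :
    Complex.I * ∫ ξ in ν..x, expCoeff lam p (x - ξ + ν) * expCoeff lam q ξ =
      ∑ k ∈ Finset.range (p + 1),
        (expCoeff lam k ν * expCoeff lam (p + q + 1 - k) x -
          expCoeff lam k x * expCoeff lam (p + q + 1 - k) ν) := by
  have hr : ∀ ξ : ℝ, HasDerivAt (fun t : ℝ => x - t + ν) (-1) ξ := fun ξ =>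
    ((hasDerivAt_id ξ).const_sub x).add_const ν
  induction p generalizing q with
  | zero =>
    have hd : ∀ ξ ∈ Set.uIcc ν x, HasDerivAt
        (fun t : ℝ => expCoeff lam 0 (x - t + ν) * expCoeff lam (q + 1) t)
        (Complex.I * (expCoeff lam 0 (x - ξ + ν) * expCoeff lam q ξ)) ξ := by
      intro ξ _
      refine (((hasDerivAt_expCoeff_zero lam (x - ξ + ν)).scomp ξ (hr ξ)).mul
        (hasDerivAt_expCoeff_succ lam q ξ)).congr_deriv ?_
      simp only [neg_smul, one_smul]
      ring
    have := intervalIntegral.integral_eq_sub_of_hasDerivAt hd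
      (Continuous.intervalIntegrable (by fun_prop) _ _)
    rw [intervalIntegral.integral_const_mul] at this
    rw [this]
    simp
  | succ p ih =>
    -- Integration by parts: the `lam` terms cancel, and the integral for `(p+1, q)` becomes the one
    -- for `(p, q+1)` plus boundary values. Hence the induction runs with `q` free.
    have hd : ∀ ξ ∈ Set.uIcc ν x, HasDerivAt
        (fun t : ℝ => expCoeff lam (p + 1) (x - t + ν) * expCoeff lam (q + 1) t)
        (Complex.I * (expCoeff lam (p + 1) (x - ξ + ν) * expCoeff lam q ξ) -
          Complex.I * (expCoeff lam p (x - ξ + ν) * expCoeff lam (q + 1) ξ)) ξ := by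
      intro ξ _
      refine (((hasDerivAt_expCoeff_succ lam p (x - ξ + ν)).scomp ξ (hr ξ)).mul
        (hasDerivAt_expCoeff_succ lam q ξ)).congr_deriv ?_
      simp only [neg_smul, one_smul]
      ring
    have := intervalIntegral.integral_eq_sub_of_hasDerivAt hd
      (Continuous.intervalIntegrable (by fun_prop) _ _)
    rw [intervalIntegral.integral_sub (Continuous.intervalIntegrable (by fun_prop) _ _)
      (Continuous.intervalIntegrable (by fun_prop) _ _), intervalIntegral.integral_const_mul,
      intervalIntegral.integral_const_mul, ih (q + 1), sub_eq_iff_eq_add] at this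
    rw [this, Finset.sum_range_succ _ (p + 1), add_comm]
    have h1 : p + 1 + q + 1 - (p + 1) = q + 1 := by omega
    have h2 : p + (q + 1) + 1 = p + 1 + q + 1 := by omega
    simp [h1, h2]

/-! ### Taylor series as formal power series -/

/-- The Taylor series of `f` at `a`, as a formal power series. -/
def taylorPS (f : ℂ → ℂ) (a : ℂ) : PowerSeries ℂ :=
  PowerSeries.mk fun k => iteratedDeriv k f a / (k.factorial : ℂ)

theorem taylorPS_congr {f g : ℂ → ℂ} {a : ℂ} (h : f =ᶠ[𝓝 a] g) : taylorPS f a = taylorPS g a := by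
  ext k
  simp [taylorPS, h.iteratedDeriv_eq k]

theorem taylorPS_mul {f g : ℂ → ℂ} {a : ℂ} (hf : AnalyticAt ℂ f a) (hg : AnalyticAt ℂ g a) :
    taylorPS (f * g) a = taylorPS f a * taylorPS g a := by
  ext k
  simp only [taylorPS, PowerSeries.coeff_mk, PowerSeries.coeff_mul]
  rw [iteratedDeriv_mul hf.contDiffAt hg.contDiffAt, Finset.Nat.sum_antidiagonal_eq_sum_range_succ
    (fun i j => iteratedDeriv i f a / (i.factorial : ℂ) * (iteratedDeriv j g a / (j.factorial : ℂ))),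
    Finset.sum_div]
  refine Finset.sum_congr rfl fun i hi => ?_
  have hik : i ≤ k := Nat.lt_succ_iff.1 (Finset.mem_range.1 hi)
  have h1 : (k.factorial : ℂ) ≠ 0 := by exact_mod_cast Nat.factorial_ne_zero _
  have h2 : (i.factorial : ℂ) ≠ 0 := by exact_mod_cast Nat.factorial_ne_zero _
  have h3 : ((k - i).factorial : ℂ) ≠ 0 := by exact_mod_cast Nat.factorial_ne_zero _
  rw [Nat.cast_choose ℂ hik]
  field_simp

theorem taylorPS_one (a : ℂ) : taylorPS 1 a = 1 := by
  ext k
  rcases k with _ | k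
  · simp [taylorPS]
  · have : iteratedDeriv (k + 1) (1 : ℂ → ℂ) a = 0 := by
      have := iteratedDeriv_const (n := k + 1) (c := (1 : ℂ)) (x := a)
      rwa [if_neg k.succ_ne_zero] at this
    simp [taylorPS, this, PowerSeries.coeff_one]

theorem taylorPS_sub_self (a : ℂ) : taylorPS (fun z => z - a) a = PowerSeries.X := by
  ext k
  rcases k with _ | _ | k
  · simp [taylorPS]
  · simp [taylorPS]
  · have hd : deriv (fun z : ℂ => z - a) = fun _ => 1 := by
      ext z; simp
    simp [taylorPS, iteratedDeriv_succ', hd, PowerSeries.coeff_X]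

theorem taylorPS_sub_pow (a : ℂ) (m : ℕ) :
    taylorPS (fun z => (z - a) ^ m) a = PowerSeries.X ^ m := by
  induction m with
  | zero =>
    have : (fun z : ℂ => (z - a) ^ 0) = 1 := by
      ext z; simp
    rw [this, taylorPS_one, pow_zero]
  | succ m ih =>
    have : (fun z : ℂ => (z - a) ^ (m + 1)) = (fun z => (z - a) ^ m) * fun z => z - a := by
      ext z; simp [pow_succ]
    rw [this, taylorPS_mul (by fun_prop) (by fun_prop), ih, taylorPS_sub_self, pow_succ]

/-- Uniqueness of power series expansions; this turns a termwise integrated series for `Δ` into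
analyticity and Taylor coefficients. -/
theorem analyticAt_and_coeff_taylorPS_of_hasSum {f : ℂ → ℂ} {a : ℂ} {c : ℕ → ℂ}
    (h : ∀ t, HasSum (fun k => t ^ k * c k) (f (a + t))) :
    AnalyticAt ℂ f a ∧ taylorPS f a = PowerSeries.mk c := by
  have hp : HasFPowerSeriesAt f (FormalMultilinearSeries.ofScalars ℂ c) a := by
    rw [hasFPowerSeriesAt_iff]
    refine Eventually.of_forall fun t => ?_
    simpa [FormalMultilinearSeries.coeff_ofScalars] using h t
  refine ⟨hp.analyticAt, ?_⟩
  have := hp.analyticAt.hasFPowerSeriesAt.eq_formalMultilinearSeries hp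
  ext k
  have hk := congrArg (fun s => s.coeff k) this
  simpa [taylorPS, FormalMultilinearSeries.coeff_ofScalars] using hk

/-- If `F` is divisible by `X ^ m` and `p, q < m`, the coefficient of `X ^ (p + q + 1)` in
`A * B * F` only involves the coefficients of `A` up to `p` and those of `B` up to `q`. -/
theorem sum_coeff_mul_coeff_mul_coeff {A B F : PowerSeries ℂ} {m p q : ℕ}
    (hF : PowerSeries.X ^ m ∣ F) (hp : p < m) (hq : q < m) :
    ∑ i ∈ Finset.range (p + 1), ∑ j ∈ Finset.range (q + 1),
      A.coeff i * B.coeff j * F.coeff ((p - i) + (q - j) + 1) =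
      (A * (B * F)).coeff (p + q + 1) := by
  have hBF : PowerSeries.X ^ m ∣ B * F := hF.mul_left B
  rw [PowerSeries.X_pow_dvd_iff] at hF hBF
  rw [PowerSeries.coeff_mul, Finset.Nat.sum_antidiagonal_eq_sum_range_succ
    (fun i j => A.coeff i * (B * F).coeff j)]
  -- A term with `i > p` meets a coefficient of `B * F` of index at most `q < m`; below, one with `j
  -- > q` meets a coefficient of `F` of index at most `p < m`. Both vanish.
  rw [← Finset.sum_subset (s₁ := Finset.range (p + 1)) (s₂ := Finset.range (p + q + 1).succ)]
  · refine Finset.sum_congr rfl fun i hi => ?_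
    have hi' := Finset.mem_range.1 hi
    simp only [mul_assoc]
    rw [← Finset.mul_sum, PowerSeries.coeff_mul, Finset.Nat.sum_antidiagonal_eq_sum_range_succ
      (fun i j => B.coeff i * F.coeff j)]
    congr 1
    rw [← Finset.sum_subset (s₁ := Finset.range (q + 1))
      (s₂ := Finset.range (p + q + 1 - i).succ)]
    · refine Finset.sum_congr rfl fun j hj => ?_
      have hj' := Finset.mem_range.1 hj
      have : p - i + (q - j) + 1 = p + q + 1 - i - j := by omega
      rw [this]
    · intro j hj
      simp only [Finset.mem_range] at *
      omega
    · intro j hj hj'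
      simp only [Finset.mem_range] at *
      rw [hF _ (by omega), mul_zero]
  · intro i hi
    simp only [Finset.mem_range] at *
    omega
  · intro i hi hi'
    simp only [Finset.mem_range] at *
    rw [hBF _ (by omega), mul_zero]

/-! ### Moments of `σ` and the expansion of `Δ` -/

theorem contDiff_expCoeff (lam : ℂ) (k : ℕ) : ContDiff ℝ 1 (expCoeff lam k) := by
  have : ContDiff ℝ 1 (fun x : ℝ => (x : ℂ)) := Complex.ofRealCLM.contDiff
  unfold expCoeff
  fun_prop

theorem intervalIntegrable_conj {b : ℝ} (hb : 0 < b) {σ : ℝ → ℂ}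
    (hσ : MemLp σ 2 (volume.restrict (Set.Ioo 0 b))) :
    IntervalIntegrable (fun x => starRingEnd ℂ (σ x)) volume 0 b := by
  rw [intervalIntegrable_iff, Set.uIoc_of_le hb.le, integrableOn_Ioc_iff_integrableOn_Ioo]
  have h : Integrable σ (volume.restrict (Set.Ioo 0 b)) := hσ.integrable (by norm_num)
  exact Complex.conjCLE.toContinuousLinearMap.integrable_comp h

/-- The pairing of `expCoeff lam k` with `σ`. -/
def moment (b : ℝ) (σ : ℝ → ℂ) (lam : ℂ) (k : ℕ) : ℂ :=
  ∫ x in (0 : ℝ)..b, starRingEnd ℂ (σ x) * expCoeff lam k x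

theorem hasSum_moment {b : ℝ} (hb : 0 < b) {σ : ℝ → ℂ}
    (hσ : IntervalIntegrable (fun x => starRingEnd ℂ (σ x)) volume 0 b) (lam t : ℂ) :
    HasSum (fun k => t ^ k * moment b σ lam k)
      (∫ x in (0 : ℝ)..b, Complex.exp (Complex.I * (lam + t) * x) * starRingEnd ℂ (σ x)) := by
  have hexp : ∀ r : ℝ, HasSum (fun k : ℕ => r ^ k / (k.factorial : ℝ)) (Real.exp r) := fun r => by
    rw [Real.exp_eq_exp_ℝ]
    exact NormedSpace.expSeries_div_hasSum_exp r
  have hB : ∀ x : ℝ, HasSum (fun k : ℕ => ‖starRingEnd ℂ (σ x)‖ *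
      ((‖t‖ * b) ^ k / (k.factorial : ℝ) * ‖Complex.exp (Complex.I * lam * x)‖))
      (‖starRingEnd ℂ (σ x)‖ *
        (Real.exp (‖t‖ * b) * ‖Complex.exp (Complex.I * lam * x)‖)) := fun x =>
    ((hexp (‖t‖ * b)).mul_right _).mul_left _
  have hs : ∀ k : ℕ, t ^ k * moment b σ lam k =
      ∫ x in (0 : ℝ)..b, starRingEnd ℂ (σ x) * (t ^ k * expCoeff lam k x) := fun k => by
    rw [moment, ← intervalIntegral.integral_const_mul]
    congr 1
    ext x
    ring
  simp only [hs]
  refine intervalIntegral.hasSum_integral_of_dominated_convergence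
    -- The majorant uses `0 < x ≤ b`; its sum over `k` is integrable because `σ` is.
    (fun k x => ‖starRingEnd ℂ (σ x)‖ *
      ((‖t‖ * b) ^ k / (k.factorial : ℝ) * ‖Complex.exp (Complex.I * lam * x)‖)) ?_ ?_ ?_ ?_ ?_
  · intro k
    have hi : IntervalIntegrable (fun x => starRingEnd ℂ (σ x) * (t ^ k * expCoeff lam k x))
        volume 0 b := hσ.mul_continuousOn (by fun_prop)
    exact (intervalIntegrable_iff.1 hi).aestronglyMeasurable
  · intro k
    refine Eventually.of_forall fun x hx => ?_
    rw [Set.uIoc_of_le hb.le] at hx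
    simp only [expCoeff, norm_mul, norm_div, norm_pow, Complex.norm_I, Complex.norm_real,
      Complex.norm_natCast, mul_pow, one_pow, one_mul, Real.norm_eq_abs, abs_of_pos hx.1]
    rw [← mul_assoc (‖t‖ ^ k), ← mul_div_assoc]
    have := hx.2
    have := hx.1.le
    gcongr
  · exact Eventually.of_forall fun x _ => (hB x).summable
  · simp only [fun x => (hB x).tsum_eq]
    exact hσ.norm.mul_continuousOn (by fun_prop)
  · refine Eventually.of_forall fun x _ => ?_
    have h := (NormedSpace.expSeries_div_hasSum_exp (Complex.I * t * x)).mul_left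
      (starRingEnd ℂ (σ x) * Complex.exp (Complex.I * lam * x))
    rw [← Complex.exp_eq_exp_ℂ, mul_assoc (starRingEnd ℂ (σ x)), ← Complex.exp_add,
      ← add_mul, ← mul_add, mul_comm (starRingEnd ℂ (σ x)) (Complex.exp (Complex.I * (lam + t) * x))] at h
    refine (congrArg (fun f => HasSum f _) (funext fun k => ?_)).mp h
    simp only [expCoeff, mul_pow]
    ring

/-- The Taylor coefficients of `Delta b σ` at `lam`. -/
def deltaCoeff (b : ℝ) (σ : ℝ → ℂ) (lam : ℂ) : ℕ → ℂ
  | 0 => 1 - lam * moment b σ lam 0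
  | k + 1 => -(lam * moment b σ lam (k + 1) + moment b σ lam k)

theorem hasSum_deltaCoeff {b : ℝ} (hb : 0 < b) {σ : ℝ → ℂ}
    (hσ : IntervalIntegrable (fun x => starRingEnd ℂ (σ x)) volume 0 b) (lam t : ℂ) :
    HasSum (fun k => t ^ k * deltaCoeff b σ lam k) (Delta b σ (lam + t)) := by
  have h := hasSum_moment hb hσ lam t
  -- In `-(lam + t) * ∫`, the factor `t` shifts indices by one, so the constant term is split off.
  rw [← hasSum_nat_add_iff' 1]
  have h' := (((hasSum_nat_add_iff' 1).2 h).mul_left (-lam)).add (h.mul_left (-t))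
  have hv : Delta b σ (lam + t) - ∑ i ∈ Finset.range 1, t ^ i * deltaCoeff b σ lam i =
      -lam * ((∫ x in (0 : ℝ)..b, Complex.exp (Complex.I * (lam + t) * x) *
        starRingEnd ℂ (σ x)) - ∑ i ∈ Finset.range 1, t ^ i * moment b σ lam i) +
      -t * ∫ x in (0 : ℝ)..b, Complex.exp (Complex.I * (lam + t) * x) *
        starRingEnd ℂ (σ x) := by
    simp only [Delta, deltaCoeff, Finset.sum_range_one]
    ring
  rw [hv]
  refine (congrArg (fun f => HasSum f _) (funext fun k => ?_)).mp h'
  simp only [deltaCoeff]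
  ring

/-! ### Convolution of Taylor coefficients -/

/-- This is `U(e_k) = δ_k`, with `U(y) = y(0) + i ∫ conj(σ) y'`, solved for the integral. -/
theorem integral_conj_mul_deriv_expCoeff {b : ℝ} {σ : ℝ → ℂ}
    (hσ : IntervalIntegrable (fun x => starRingEnd ℂ (σ x)) volume 0 b) (lam : ℂ) (k : ℕ) :
    ∫ μ in (0 : ℝ)..b, starRingEnd ℂ (σ μ) * deriv (expCoeff lam k) μ =
      Complex.I * ((if k = 0 then 1 else 0) - deltaCoeff b σ lam k) := by
  rcases k with _ | k
  · simp only [(hasDerivAt_expCoeff_zero lam _).deriv, deltaCoeff, moment, if_pos, sub_sub_cancel]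
    rw [← mul_assoc, ← intervalIntegral.integral_const_mul]
    congr 1
    ext x
    ring
  · simp only [(hasDerivAt_expCoeff_succ lam k _).deriv, deltaCoeff, moment, k.succ_ne_zero,
      if_false, zero_sub, neg_neg]
    rw [← intervalIntegral.integral_const_mul lam, ← intervalIntegral.integral_add
      ((hσ.mul_continuousOn (by fun_prop)).const_mul _) (hσ.mul_continuousOn (by fun_prop)),
      ← intervalIntegral.integral_const_mul]
    congr 1
    ext x
    ring

theorem integral_expCoeff_mul_eq (lam : ℂ) (p q : ℕ) (x : ℝ) :
    (fun ν : ℝ => ∫ ξ in ν..x, expCoeff lam p (x - ξ + ν) * expCoeff lam q ξ) = fun ν =>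
      ∑ k ∈ Finset.range (p + 1),
        (-Complex.I * expCoeff lam (p + q + 1 - k) x * expCoeff lam k ν -
          -Complex.I * expCoeff lam k x * expCoeff lam (p + q + 1 - k) ν) := by
  ext ν
  have h := congrArg (fun z => -Complex.I * z) (integral_expCoeff_mul lam p q ν x)
  rw [← mul_assoc, neg_mul, Complex.I_mul_I, neg_neg, one_mul] at h
  rw [h, Finset.mul_sum]
  refine Finset.sum_congr rfl fun k _ => ?_
  ring

theorem contDiff_integral_expCoeff_mul (lam : ℂ) (p q : ℕ) (x : ℝ) :
    ContDiff ℝ 1 (fun ν : ℝ => ∫ ξ in ν..x, expCoeff lam p (x - ξ + ν) * expCoeff lam q ξ) := by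
  rw [integral_expCoeff_mul_eq]
  refine ContDiff.sum fun k _ => ?_
  exact (contDiff_const.mul (contDiff_expCoeff _ _)).sub
    (contDiff_const.mul (contDiff_expCoeff _ _))

theorem conv_expCoeff {b : ℝ} {σ : ℝ → ℂ}
    (hσ : IntervalIntegrable (fun x => starRingEnd ℂ (σ x)) volume 0 b) (lam : ℂ) (p q : ℕ)
    (x : ℝ) :
    conv b σ (expCoeff lam p) (expCoeff lam q) x =
      ∑ k ∈ Finset.range (p + 1),
        (deltaCoeff b σ lam k * expCoeff lam (p + q + 1 - k) x -
          deltaCoeff b σ lam (p + q + 1 - k) * expCoeff lam k x) := by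
  have h0 := integral_expCoeff_mul lam p q 0 x
  simp only [add_zero] at h0
  have hd : ∀ k, IntervalIntegrable
      (fun μ => starRingEnd ℂ (σ μ) * deriv (expCoeff lam k) μ) volume 0 b := fun k =>
    hσ.mul_continuousOn ((contDiff_expCoeff lam k).continuous_deriv le_rfl).continuousOn
  have hderiv : ∀ μ : ℝ, starRingEnd ℂ (σ μ) *
      deriv (fun ν : ℝ => ∫ ξ in ν..x, expCoeff lam p (x - ξ + ν) * expCoeff lam q ξ) μ =
      ∑ k ∈ Finset.range (p + 1),
        (-Complex.I * expCoeff lam (p + q + 1 - k) x *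
            (starRingEnd ℂ (σ μ) * deriv (expCoeff lam k) μ) -
          -Complex.I * expCoeff lam k x *
            (starRingEnd ℂ (σ μ) * deriv (expCoeff lam (p + q + 1 - k)) μ)) := by
    intro μ
    have hE := fun k => (differentiable_expCoeff lam k μ).hasDerivAt
    rw [integral_expCoeff_mul_eq, (HasDerivAt.fun_sum fun k _ =>
      ((hE k).const_mul (-Complex.I * expCoeff lam (p + q + 1 - k) x)).fun_sub
      ((hE (p + q + 1 - k)).const_mul (-Complex.I * expCoeff lam k x))).deriv, Finset.mul_sum]
    refine Finset.sum_congr rfl fun k _ => ?_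
    ring
  rw [conv, h0]
  simp only [hderiv]
  rw [intervalIntegral.integral_finsetSum fun k _ =>
    ((hd _).const_mul _).sub ((hd _).const_mul _), ← Finset.sum_sub_distrib]
  refine Finset.sum_congr rfl fun k _ => ?_
  rw [intervalIntegral.integral_sub ((hd _).const_mul _) ((hd _).const_mul _),
    intervalIntegral.integral_const_mul, intervalIntegral.integral_const_mul,
    integral_conj_mul_deriv_expCoeff hσ, integral_conj_mul_deriv_expCoeff hσ, expCoeff_zero_right,
    expCoeff_zero_right]
  generalize (if k = 0 then (1 : ℂ) else 0) = u
  generalize (if p + q + 1 - k = 0 then (1 : ℂ) else 0) = v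
  linear_combination (expCoeff lam (p + q + 1 - k) x * (u - deltaCoeff b σ lam k) -
    expCoeff lam k x * (v - deltaCoeff b σ lam (p + q + 1 - k))) * Complex.I_mul_I

/-- Bilinearity requires differentiability of the inner integrals in `ν` and integrability against
`conj σ`; both follow from `contDiff_integral_expCoeff_mul`. -/
theorem conv_sum_expCoeff {b : ℝ} {σ : ℝ → ℂ}
    (hσ : IntervalIntegrable (fun x => starRingEnd ℂ (σ x)) volume 0 b) (lam : ℂ) (x : ℝ)
    (s t : Finset ℕ) (a c : ℕ → ℂ) (k l : ℕ → ℕ) :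
    conv b σ (fun y => ∑ i ∈ s, a i * expCoeff lam (k i) y)
        (fun y => ∑ j ∈ t, c j * expCoeff lam (l j) y) x =
      ∑ i ∈ s, ∑ j ∈ t, a i * c j * conv b σ (expCoeff lam (k i)) (expCoeff lam (l j)) x := by
  have hC := fun p q => contDiff_integral_expCoeff_mul lam p q x
  have hd : ∀ p q, IntervalIntegrable (fun μ => starRingEnd ℂ (σ μ) *
      deriv (fun ν : ℝ => ∫ ξ in ν..x, expCoeff lam p (x - ξ + ν) * expCoeff lam q ξ) μ)
      volume 0 b := fun p q =>
    hσ.mul_continuousOn ((hC p q).continuous_deriv le_rfl).continuousOn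
  -- The shift `y` is kept apart from the endpoint `ν` so that `y = ν` serves the derivative term
  -- and `ν = y = 0` the first term of `conv`.
  have hH : ∀ (ν y : ℝ), ∫ ξ in ν..x, (∑ i ∈ s, a i * expCoeff lam (k i) (x - ξ + y)) *
      (∑ j ∈ t, c j * expCoeff lam (l j) ξ) = ∑ i ∈ s, ∑ j ∈ t, a i * c j *
        ∫ ξ in ν..x, expCoeff lam (k i) (x - ξ + y) * expCoeff lam (l j) ξ := by
    intro ν y
    have : ∀ ξ : ℝ, (∑ i ∈ s, a i * expCoeff lam (k i) (x - ξ + y)) *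
        (∑ j ∈ t, c j * expCoeff lam (l j) ξ) = ∑ i ∈ s, ∑ j ∈ t, a i * c j *
        (expCoeff lam (k i) (x - ξ + y) * expCoeff lam (l j) ξ) := fun ξ => by
      rw [Finset.sum_mul_sum]
      refine Finset.sum_congr rfl fun i _ => Finset.sum_congr rfl fun j _ => ?_
      ring
    simp only [this]
    rw [intervalIntegral.integral_finsetSum fun i _ =>
      Continuous.intervalIntegrable (by fun_prop) _ _]
    refine Finset.sum_congr rfl fun i _ => ?_
    rw [intervalIntegral.integral_finsetSum fun j _ =>
      Continuous.intervalIntegrable (by fun_prop) _ _]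
    simp only [intervalIntegral.integral_const_mul]
  have hderiv : ∀ μ : ℝ, starRingEnd ℂ (σ μ) * deriv (fun ν : ℝ => ∑ i ∈ s, ∑ j ∈ t, a i * c j *
        ∫ ξ in ν..x, expCoeff lam (k i) (x - ξ + ν) * expCoeff lam (l j) ξ) μ =
      ∑ i ∈ s, ∑ j ∈ t, a i * c j * (starRingEnd ℂ (σ μ) *
        deriv (fun ν : ℝ => ∫ ξ in ν..x, expCoeff lam (k i) (x - ξ + ν) * expCoeff lam (l j) ξ)
          μ) := by
    intro μ
    rw [(HasDerivAt.fun_sum fun i _ => HasDerivAt.fun_sum fun j _ =>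
      (((hC (k i) (l j)).differentiable one_ne_zero μ).hasDerivAt.const_mul (a i * c j))).deriv,
      Finset.mul_sum]
    refine Finset.sum_congr rfl fun i _ => ?_
    rw [Finset.mul_sum]
    refine Finset.sum_congr rfl fun j _ => ?_
    ring
  have hds : ∀ i, IntervalIntegrable (fun μ => ∑ j ∈ t, a i * c j * (starRingEnd ℂ (σ μ) *
      deriv (fun ν : ℝ => ∫ ξ in ν..x, expCoeff lam (k i) (x - ξ + ν) * expCoeff lam (l j) ξ) μ))
      volume 0 b := fun i => by
    simpa only [Finset.sum_fn] using
      IntervalIntegrable.sum t fun j _ => (hd (k i) (l j)).const_mul (a i * c j)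
  have h0 := hH 0 0
  simp only [add_zero] at h0
  simp only [conv, hH, h0, hderiv]
  rw [intervalIntegral.integral_finsetSum fun i _ => hds i, Finset.mul_sum, ← Finset.sum_sub_distrib]
  refine Finset.sum_congr rfl fun i _ => ?_
  rw [intervalIntegral.integral_finsetSum fun j _ => (hd (k i) (l j)).const_mul (a i * c j),
    Finset.mul_sum, ← Finset.sum_sub_distrib]
  refine Finset.sum_congr rfl fun j _ => ?_
  rw [intervalIntegral.integral_const_mul]
  ring

/-! ### Factorization at the zero and generating series of the root functions -/

/-- `Δ` has Taylor series `X ^ m * G` at a zero of multiplicity `m`, and the Taylor series of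
`regQuot` is the inverse of `G`. -/
theorem exists_taylorPS_factorization {b : ℝ} {σ : ℝ → ℂ} {lam : ℂ}
    (hΔ : AnalyticAt ℂ (Delta b σ) lam) (htop : analyticOrderAt (Delta b σ) lam ≠ ⊤) :
    ∃ G : PowerSeries ℂ, taylorPS (Delta b σ) lam = PowerSeries.X ^ mult b σ lam * G ∧
      taylorPS (regQuot b σ lam) lam * G = 1 := by
  obtain ⟨g, hg, hg0, hgΔ⟩ := (hΔ.analyticOrderNatAt_eq_iff htop).1 rfl
  change ∀ᶠ z in 𝓝 lam, Delta b σ z = (z - lam) ^ mult b σ lam • g z at hgΔ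
  have hinv : AnalyticAt ℂ g⁻¹ lam := hg.inv hg0
  have hpunct : (fun z => (z - lam) ^ mult b σ lam / Delta b σ z) =ᶠ[𝓝[≠] lam] g⁻¹ := by
    filter_upwards [eventually_nhdsWithin_of_eventually_nhds hgΔ, self_mem_nhdsWithin] with z hz hne
    have h : (z - lam) ^ mult b σ lam ≠ 0 := pow_ne_zero _ (sub_ne_zero.2 hne)
    rw [hz, smul_eq_mul, Pi.inv_apply, div_mul_cancel_left₀ h]
  have hlim : limUnder (𝓝[≠] lam) (fun z => (z - lam) ^ mult b σ lam / Delta b σ z) =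
      g⁻¹ lam :=
    ((hinv.continuousAt.tendsto.mono_left nhdsWithin_le_nhds).congr' hpunct.symm).limUnder_eq
  have hreg : regQuot b σ lam =ᶠ[𝓝 lam] g⁻¹ := by
    filter_upwards [eventually_nhdsWithin_iff.1 hpunct] with z hz
    rcases eq_or_ne z lam with rfl | hne
    · rw [regQuot, Function.update_self, hlim]
    · rw [regQuot, Function.update_of_ne hne]
      exact hz hne
  refine ⟨taylorPS g lam, ?_, ?_⟩
  · rw [← taylorPS_sub_pow, ← taylorPS_mul (by fun_prop) hg]
    exact taylorPS_congr hgΔ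
  · rw [taylorPS_congr hreg, ← taylorPS_mul hinv hg, ← taylorPS_one lam]
    refine taylorPS_congr ?_
    filter_upwards [hg.continuousAt.eventually_ne hg0] with z hz
    simp [hz]

/-- The exponential `z ↦ exp(i z x)` as a formal power series at `lam`. -/
def expPS (lam : ℂ) (x : ℝ) : PowerSeries ℂ :=
  PowerSeries.mk fun k => expCoeff lam k x

theorem rootFun_eq_sum (b : ℝ) (σ : ℝ → ℂ) (lam : ℂ) (s : ℕ) :
    rootFun b σ lam s = fun x => ∑ j ∈ Finset.range (s + 1),
      -(taylorPS (regQuot b σ lam) lam).coeff j * expCoeff lam (s - j) x := by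
  ext x
  simp only [rootFun, taylorPS, PowerSeries.coeff_mk, expCoeff, dCoeff, neg_mul,
    Finset.sum_neg_distrib]

theorem rootFun_eq_coeff (b : ℝ) (σ : ℝ → ℂ) (lam : ℂ) (s : ℕ) (x : ℝ) :
    rootFun b σ lam s x = -(taylorPS (regQuot b σ lam) lam * expPS lam x).coeff s := by
  rw [rootFun_eq_sum, PowerSeries.coeff_mul, Finset.Nat.sum_antidiagonal_eq_sum_range_succ
    (fun i j => (taylorPS (regQuot b σ lam) lam).coeff i * (expPS lam x).coeff j)]
  simp [expPS]

theorem conv_expCoeff_eq_coeff {b : ℝ} {σ : ℝ → ℂ}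
    (hσ : IntervalIntegrable (fun x => starRingEnd ℂ (σ x)) volume 0 b) (lam : ℂ) {m p q : ℕ}
    (hm : ∀ k < m, deltaCoeff b σ lam k = 0) (hp : p < m) (hq : q < m) (x : ℝ) :
    conv b σ (expCoeff lam p) (expCoeff lam q) x =
      -(PowerSeries.mk (deltaCoeff b σ lam) * expPS lam x).coeff (p + q + 1) := by
  rw [conv_expCoeff hσ, mul_comm, PowerSeries.coeff_mul,
    Finset.Nat.sum_antidiagonal_eq_sum_range_succ
    (fun i j => (expPS lam x).coeff i * (PowerSeries.mk (deltaCoeff b σ lam)).coeff j),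
    ← Finset.sum_subset (s₁ := Finset.range (p + 1)) (s₂ := Finset.range (p + q + 1).succ),
    ← Finset.sum_neg_distrib]
  · refine Finset.sum_congr rfl fun k hk => ?_
    rw [hm k (by have := Finset.mem_range.1 hk; omega)]
    simp only [expPS, PowerSeries.coeff_mk]
    ring
  · intro k hk
    simp only [Finset.mem_range] at *
    omega
  · intro k hk hk'
    simp only [Finset.mem_range, PowerSeries.coeff_mk] at *
    -- For `k > p` the index `p + q + 1 - k` is at most `q < m`.
    rw [hm _ (by omega), mul_zero]

end SegmentConv

end

theorem lemma4p1 (b : ℝ) (hb : 0 < b) (σ : ℝ → ℂ)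
    (hσ : MemLp σ 2 (volume.restrict (Set.Ioo 0 b)))
    (lam : ℂ) (hlam : SegmentConv.Delta b σ lam = 0) :
    (∀ p q : ℕ, p < SegmentConv.mult b σ lam → q < SegmentConv.mult b σ lam →
      ∀ x ∈ Set.Icc (0 : ℝ) b,
        SegmentConv.conv b σ (SegmentConv.rootFun b σ lam p) (SegmentConv.rootFun b σ lam q) x =
          if p + q + 1 < SegmentConv.mult b σ lam then 0
          else SegmentConv.rootFun b σ lam (p + q + 1 - SegmentConv.mult b σ lam) x) ∧
    (∀ x ∈ Set.Icc (0 : ℝ) b,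
      SegmentConv.conv b σ (SegmentConv.rootFun b σ lam (SegmentConv.mult b σ lam - 1))
          (SegmentConv.rootFun b σ lam (SegmentConv.mult b σ lam - 1)) x =
        SegmentConv.rootFun b σ lam (SegmentConv.mult b σ lam - 1) x) := by
  have hσ' := SegmentConv.intervalIntegrable_conj hb hσ
  have hT := fun z => SegmentConv.analyticAt_and_coeff_taylorPS_of_hasSum
    (SegmentConv.hasSum_deltaCoeff hb hσ' z)
  -- Infinite order would force `Δ = 0` everywhere, against `Δ(0) = 1`.
  have htop : analyticOrderAt (SegmentConv.Delta b σ) lam ≠ ⊤ := by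
    intro h
    have h0 := AnalyticOnNhd.eqOn_zero_of_preconnected_of_eventuallyEq_zero
      (fun z _ => (hT z).1) isPreconnected_univ (Set.mem_univ lam)
      (analyticOrderAt_eq_top.1 h) (Set.mem_univ 0)
    simp [SegmentConv.Delta] at h0
  have hpos : 0 < SegmentConv.mult b σ lam := by
    refine Nat.pos_of_ne_zero fun h => ?_
    have h0 := Nat.cast_analyticOrderNatAt htop
    rw [show analyticOrderNatAt (SegmentConv.Delta b σ) lam = 0 from h, Nat.cast_zero] at h0
    exact (hT lam).1.analyticOrderAt_eq_zero.1 h0.symm hlam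
  obtain ⟨G, hG, hDG⟩ := SegmentConv.exists_taylorPS_factorization (hT lam).1 htop
  rw [(hT lam).2] at hG
  have hm : ∀ k < SegmentConv.mult b σ lam, SegmentConv.deltaCoeff b σ lam k = 0 := by
    simpa using PowerSeries.X_pow_dvd_iff.1 (Dvd.intro _ hG.symm)
  have main : ∀ p q : ℕ, p < SegmentConv.mult b σ lam → q < SegmentConv.mult b σ lam →
      ∀ x : ℝ,
        SegmentConv.conv b σ (SegmentConv.rootFun b σ lam p) (SegmentConv.rootFun b σ lam q) x =
          if p + q + 1 < SegmentConv.mult b σ lam then 0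
          else SegmentConv.rootFun b σ lam (p + q + 1 - SegmentConv.mult b σ lam) x := by
    intro p q hp hq x
    set m := SegmentConv.mult b σ lam with hmdef
    set A := SegmentConv.taylorPS (SegmentConv.regQuot b σ lam) lam with hA
    set E := SegmentConv.expPS lam x with hE
    have hF : PowerSeries.X ^ m ∣ PowerSeries.mk (SegmentConv.deltaCoeff b σ lam) * E :=
      (Dvd.intro _ hG.symm).mul_right E
    -- One factor `A` cancels the cofactor `G` in `Δ = X ^ m * G`.
    have hprod : A * (A * (PowerSeries.mk (SegmentConv.deltaCoeff b σ lam) * E)) =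
        PowerSeries.X ^ m * (A * E) := by
      rw [hG]
      linear_combination (PowerSeries.X ^ m * A * E) * hDG
    have hsum := SegmentConv.sum_coeff_mul_coeff_mul_coeff (A := A) (B := A) hF hp hq
    rw [hprod, PowerSeries.coeff_X_pow_mul'] at hsum
    rw [SegmentConv.rootFun_eq_coeff b σ lam (p + q + 1 - m), SegmentConv.rootFun_eq_sum,
      SegmentConv.rootFun_eq_sum, SegmentConv.conv_sum_expCoeff hσ', ← hA, ← hE]
    have hneg : ∑ i ∈ Finset.range (p + 1), ∑ j ∈ Finset.range (q + 1),
        -A.coeff i * -A.coeff j * SegmentConv.conv b σ (SegmentConv.expCoeff lam (p - i))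
          (SegmentConv.expCoeff lam (q - j)) x =
        -∑ i ∈ Finset.range (p + 1), ∑ j ∈ Finset.range (q + 1), A.coeff i * A.coeff j *
          (PowerSeries.mk (SegmentConv.deltaCoeff b σ lam) * E).coeff ((p - i) + (q - j) + 1) := by
      simp only [← Finset.sum_neg_distrib]
      refine Finset.sum_congr rfl fun i _ => Finset.sum_congr rfl fun j _ => ?_
      rw [SegmentConv.conv_expCoeff_eq_coeff hσ' lam hm (by omega) (by omega)]
      ring
    rw [hneg, hsum]
    split_ifs <;> first | omega | simp
  refine ⟨fun p q hp hq x _ => main p q hp hq x, fun x _ => ?_⟩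
  rw [main _ _ (Nat.sub_lt hpos one_pos) (Nat.sub_lt hpos one_pos), if_neg (by omega)]
  congr 1
  omega
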